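/- Let $(R,\mathfrak m)$ be a commutative noetherian local ring with $\dim R\ge 1$, and let $\mathfrak a$ be an ideal of $R$ with $\operatorname{ht}\mathfrak a=\dim R-1$. For an ideal $\mathfrak b$ of $R$, an $R$-module $M$ is called $\mathfrak b$-cofinite if $\operatorname{Supp}M\subseteq V(\mathfrak b)$ and $\operatorname{Ext}^i_R(R/\mathfrak b,M)$ is finitely generated for all $i\ge 0$; let $\mathcal S_{\mathcal A.\mathfrak b\text{-cof}}$ denote the class of all $R$-modules that are both artinian and $\mathfrak b$-cofinite. A class $\mathcal S$ of $R$-modules is said to satisfy the condition $C_{\mathfrak b}$ if every $R$-module $M$ with $M=\Gamma_{\mathfrak b}(M):=\bigcup_{n\ge 0}(0:_M\mathfrak b^n)$ and $(0:_M\mathfrak b)\in\mathcal S$ belongs to $\mathcal S$. The Melkersson subset $\mathbb M[\mathcal S]$ is the set of all prime ideals $\mathfrak p$ of $R$ such that $\mathcal S$ satisfies $C_{\mathfrak p}$, and $\mathbb M[\mathcal S]_{\ge i}$ is the set of all $\mathfrak p\in\mathbb M[\mathcal S]$ with $\operatorname{ht}\mathfrak p\ge i$. Let $\operatorname{Min}\mathfrak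 a$ be the set of minimal primes over $\mathfrak a$. Then: (i) $\mathcal S_{\mathcal A.\mathfrak a\text{-cof}}=\bigcap_{\mathfrak p\in\operatorname{Min}\mathfrak a}\mathcal S_{\mathcal A.\mathfrak p\text{-cof}}$. (ii) $\mathbb M[\mathcal S_{\mathcal A.\mathfrak a\text{-cof}}]_{\ge\dim R-1}\subseteq\operatorname{Min}\mathfrak a$. Moreover, the set $\mathbb M[\mathcal S_{\mathcal A.\mathfrak a\text{-cof}}]_{\ge\dim R-1}$ contains at most one element. -/

import Mathlib

universe u

open CategoryTheory

namespace CofiniteModules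

variable {R : Type u} [CommRing R]

/-- The `𝔞`-torsion submodule `Γ_𝔞(M) = ⋃ₙ (0 :_M 𝔞ⁿ)` of `M`. -/
def gamma (𝔞 : Ideal R) (M : Type u) [AddCommGroup M] [Module R M] : Submodule R M where
  carrier := {x | ∃ n : ℕ, ∀ r ∈ 𝔞 ^ n, r • x = 0}
  zero_mem' := ⟨0, fun r _ => smul_zero r⟩
  add_mem' := by
    rintro x y ⟨n, hn⟩ ⟨k, hk⟩
    refine ⟨max n k, fun r hr => ?_⟩
    rw [smul_add, hn r (Ideal.pow_le_pow_right (le_max_left n k) hr),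
      hk r (Ideal.pow_le_pow_right (le_max_right n k) hr), add_zero]
  smul_mem' := by
    rintro c x ⟨n, hn⟩
    exact ⟨n, fun r hr => by rw [smul_comm, hn r hr, smul_zero]⟩

/-- `M` is `𝔞`-cofinite: `Supp M ⊆ V(𝔞)` and `Ext^i_R(R/𝔞, M)` is a finitely generated
`R`-module for every `i ≥ 0`. -/
def IsCofinite (𝔞 : Ideal R) (M : ModuleCat.{u} R) : Prop :=
  Module.support R M ⊆ PrimeSpectrum.zeroLocus (𝔞 : Set R) ∧
    ∀ i : ℕ, Module.Finite R (Abelian.Ext (ModuleCat.of R (R ⧸ 𝔞)) M i)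

/-- The class of artinian `𝔞`-cofinite modules, as a full subcategory of the category of
`R`-modules. -/
def artinianCofinite (𝔞 : Ideal R) : ObjectProperty (ModuleCat.{u} R) :=
  fun M => IsArtinian R M ∧ IsCofinite 𝔞 M

/-- The condition `C_𝔞` on a class `S` of modules: if `M = Γ_𝔞(M)` and `(0 :_M 𝔞) ∈ S`, then
`M ∈ S`. -/
def SatisfiesC (𝔞 : Ideal R) (S : ObjectProperty (ModuleCat.{u} R)) : Prop :=
  ∀ M : ModuleCat.{u} R, gamma 𝔞 M = ⊤ →
    S (ModuleCat.of R (Submodule.torsionBySet R M (𝔞 : Set R))) → S M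

/-- The Melkersson subset of `S`: the primes `𝔭` for which `S` satisfies `C_𝔭`. -/
def melkerssonSubset (S : ObjectProperty (ModuleCat.{u} R)) : Set (PrimeSpectrum R) :=
  {𝔭 | SatisfiesC 𝔭.asIdeal S}

/-- The primes of height at least `i` in the Melkersson subset of `S`. -/
def melkerssonSubsetGE (S : ObjectProperty (ModuleCat.{u} R)) (i : ℕ) : Set (PrimeSpectrum R) :=
  {𝔭 | 𝔭 ∈ melkerssonSubset S ∧ (i : ℕ∞) ≤ 𝔭.asIdeal.height}

end CofiniteModules

/-! Over a noetherian local ring, an artinian module `M` is `I`-cofinite (for proper `I`) exactly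
when `(0 :_M I)` has finite length (`artinianCofinite_iff`). The hard half is finiteness of the
higher Ext modules. The modules satisfying this socle condition are closed under submodules, finite
powers and, by induction on the generators of `I`, quotients (`ArtinianSocleFinite.of_surjective`).
Dimension shifting then puts `Ext^i(N, M)` in the same class for every finite `N`; for `N = R/I` the
Ext module is killed by `I`, hence is noetherian.

Part (i) follows because a power of the product of the minimal primes lies in `𝔞`, and finiteness of
torsion passes to products of ideals.

For part (ii), take `𝔮` minimal over `𝔞` with height `dim R - 1`. If `𝔭 ⊄ 𝔮`, the module
`Frac(R/𝔮)/(R/𝔮)` is `𝔭`-torsion with `𝔭`-socle of finite length, but is not artinian `𝔞`-cofinite: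
it is killed by `𝔞`, so it would be noetherian, and divisibility would make it zero. So `C_𝔭` forces
`𝔭 ⊆ 𝔮`, and comparing heights gives `𝔭 = 𝔮`. -/

namespace CofiniteModules

/-! ### Artinian modules with finite-length `I`-torsion -/

section Torsion

universe v

variable {R : Type u} [CommRing R]
variable {M N : Type v} [AddCommGroup M] [Module R M] [AddCommGroup N] [Module R N]

/-- The map `(0 :_M I) → (0 :_N I)` induced by a linear map `M → N`. -/
def torsionMap (I : Ideal R) (f : M →ₗ[R] N) :
    Submodule.torsionBySet R M (I : Set R) →ₗ[R] Submodule.torsionBySet R N (I : Set R) :=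
  f.restrict fun m hm => by
    rw [Submodule.mem_torsionBySet_iff] at hm ⊢
    intro a
    rw [← map_smul, hm a, map_zero]

lemma torsionMap_apply (I : Ideal R) (f : M →ₗ[R] N)
    (m : Submodule.torsionBySet R M (I : Set R)) : (torsionMap I f m : N) = f m := rfl

lemma torsionMap_injective (I : Ideal R) {f : M →ₗ[R] N} (hf : Function.Injective f) :
    Function.Injective (torsionMap I f) := fun a b h =>
  Subtype.ext (hf (by simpa [torsionMap_apply] using congrArg Subtype.val h))

lemma isNoetherian_torsion_anti {I J : Ideal R} (h : I ≤ J)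
    [IsNoetherian R (Submodule.torsionBySet R M (I : Set R))] :
    IsNoetherian R (Submodule.torsionBySet R M (J : Set R)) :=
  isNoetherian_of_le (Submodule.torsionBySet_le_torsionBySet_of_subset h)

/-- Multiplication by finitely many generators of `I` gives an exact sequence `0 → (0 : I) → (0 :
IJ) → (0 : J)^t`. -/
lemma isNoetherian_torsion_mul [IsNoetherianRing R] (I J : Ideal R)
    [IsNoetherian R (Submodule.torsionBySet R M (I : Set R))]
    [IsNoetherian R (Submodule.torsionBySet R M (J : Set R))] :
    IsNoetherian R (Submodule.torsionBySet R M ((I * J : Ideal R) : Set R)) := by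
  obtain ⟨t, ht⟩ := (isNoetherianRing_iff_ideal_fg R).mp inferInstance I
  let g : Submodule.torsionBySet R M ((I * J : Ideal R) : Set R) →ₗ[R]
      (t → Submodule.torsionBySet R M (J : Set R)) :=
    LinearMap.pi fun r => LinearMap.restrict (LinearMap.lsmul R M r.1) fun m hm => by
      rw [Submodule.mem_torsionBySet_iff] at hm ⊢
      intro a
      have hr : r.1 ∈ I := ht ▸ Ideal.subset_span r.2
      have := hm ⟨r.1 * a.1, Ideal.mul_mem_mul hr a.2⟩
      simpa [smul_smul, mul_comm] using this
  let f : Submodule.torsionBySet R M (I : Set R) →ₗ[R]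
      Submodule.torsionBySet R M ((I * J : Ideal R) : Set R) :=
    Submodule.inclusion (Submodule.torsionBySet_le_torsionBySet_of_subset
      (Ideal.mul_le_left : I * J ≤ I))
  refine isNoetherian_of_range_eq_ker f g ?_
  apply le_antisymm
  · rintro _ ⟨m, rfl⟩
    rw [LinearMap.mem_ker]
    ext r
    have hr : r.1 ∈ I := ht ▸ Ideal.subset_span r.2
    exact (Submodule.mem_torsionBySet_iff _ _).mp m.2 ⟨r.1, hr⟩
  · intro m hm
    refine ⟨⟨m.1, ?_⟩, rfl⟩
    have hI : (I : Set R) = (Submodule.span R (t : Set R) : Submodule R R) :=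
      congrArg _ ht.symm
    rw [hI, ← Submodule.torsionBySet_eq_torsionBySet_span, Submodule.mem_torsionBySet_iff]
    intro r
    exact congrArg Subtype.val (congrFun (LinearMap.mem_ker.mp hm) ⟨r.1, r.2⟩)

lemma isNoetherian_torsion_pow [IsNoetherianRing R] (I : Ideal R)
    [IsNoetherian R (Submodule.torsionBySet R M (I : Set R))] (n : ℕ) :
    IsNoetherian R (Submodule.torsionBySet R M ((I ^ n : Ideal R) : Set R)) := by
  induction n with
  | zero =>
    have : Submodule.torsionBySet R M ((I ^ 0 : Ideal R) : Set R) = ⊥ := by simp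
    rw [this]
    infer_instance
  | succ n ih =>
    rw [pow_succ]
    exact isNoetherian_torsion_mul _ _

lemma isNoetherian_torsion_prod [IsNoetherianRing R] (s : Finset (Ideal R))
    (h : ∀ I ∈ s, IsNoetherian R (Submodule.torsionBySet R M (I : Set R))) :
    IsNoetherian R (Submodule.torsionBySet R M ((∏ I ∈ s, I : Ideal R) : Set R)) := by
  classical
  induction s using Finset.induction_on with
  | empty =>
    have : Submodule.torsionBySet R M ((∏ I ∈ (∅ : Finset (Ideal R)), I : Ideal R) : Set R) = ⊥ := by
      simp
    rw [this]
    infer_instance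
  | insert I s hI ih =>
    rw [Finset.prod_insert hI]
    have := h I (Finset.mem_insert_self I s)
    have := ih fun J hJ => h J (Finset.mem_insert_of_mem hJ)
    exact isNoetherian_torsion_mul _ _

/-- `M` is artinian and `(0 :_M I)` is noetherian, that is, of finite length. -/
structure ArtinianSocleFinite (I : Ideal R) (M : Type v) [AddCommGroup M] [Module R M] : Prop where
  isArtinian : IsArtinian R M
  isNoetherian : IsNoetherian R (Submodule.torsionBySet R M (I : Set R))

namespace ArtinianSocleFinite

variable {I : Ideal R}

lemma of_injective (h : ArtinianSocleFinite I N) (f : M →ₗ[R] N) (hf : Function.Injective f) :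
    ArtinianSocleFinite I M := by
  have := h.1
  have := h.2
  exact ⟨isArtinian_of_injective f hf,
    isNoetherian_of_injective (torsionMap I f) (torsionMap_injective I hf)⟩

lemma of_submodule_quotient (P : Submodule R M) (hP : ArtinianSocleFinite I P)
    (hQ : ArtinianSocleFinite I (M ⧸ P)) : ArtinianSocleFinite I M := by
  have := hP.1
  have := hQ.1
  have := hP.2
  have := hQ.2
  refine ⟨isArtinian_of_range_eq_ker P.subtype P.mkQ (by simp), ?_⟩
  refine isNoetherian_of_range_eq_ker (torsionMap I P.subtype) (torsionMap I P.mkQ) ?_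
  apply le_antisymm
  · rintro _ ⟨m, rfl⟩
    exact Subtype.ext ((Submodule.Quotient.mk_eq_zero P).mpr m.1.2)
  · intro m hm
    have hmP : m.1 ∈ P := (Submodule.Quotient.mk_eq_zero P).mp (congrArg Subtype.val hm)
    refine ⟨⟨⟨m.1, hmP⟩, ?_⟩, rfl⟩
    rw [Submodule.mem_torsionBySet_iff]
    exact fun a => Subtype.ext ((Submodule.mem_torsionBySet_iff _ _).mp m.2 a)

lemma pi (h : ArtinianSocleFinite I M) (n : ℕ) : ArtinianSocleFinite I (Fin n → M) := by
  have := h.1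
  have := h.2
  refine ⟨inferInstance, ?_⟩
  refine isNoetherian_of_injective
    (LinearMap.pi fun i => torsionMap I (LinearMap.proj i) :
      Submodule.torsionBySet R (Fin n → M) (I : Set R) →ₗ[R]
        Fin n → Submodule.torsionBySet R M (I : Set R)) fun a b hab => ?_
  ext i
  exact congrArg Subtype.val (congrFun hab i)

/-- Whatever is killed by `x ^ k` and `I` is killed by `(x ^ k) + I`, which contains a power of `(x)
+ I`. -/
lemma torsionBy_pow [IsNoetherianRing R] {x : R} (h : ArtinianSocleFinite (Ideal.span {x} ⊔ I) M)
    (k : ℕ) : ArtinianSocleFinite I (Submodule.torsionBy R M (x ^ k)) := by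
  have := h.1
  have := h.2
  refine ⟨inferInstance, ?_⟩
  have := isNoetherian_torsion_pow (M := M) (Ideal.span {x} ⊔ I) (k + 1)
  have hle : (Ideal.span {x} ⊔ I) ^ (k + 1) ≤ Ideal.span {x ^ k} ⊔ I := by
    simpa [Ideal.span_singleton_pow] using
      Ideal.sup_pow_add_le_pow_sup_pow (I := Ideal.span {x}) (J := I) (n := k) (m := 1)
  have := isNoetherian_torsion_anti (M := M) hle
  let f : Submodule.torsionBySet R (Submodule.torsionBy R M (x ^ k)) (I : Set R) →ₗ[R]
      Submodule.torsionBySet R M ((Ideal.span {x ^ k} ⊔ I : Ideal R) : Set R) :=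
    LinearMap.codRestrict _ ((Submodule.subtype _).comp (Submodule.subtype _)) fun m => by
      rw [Submodule.mem_torsionBySet_iff]
      rintro ⟨a, ha⟩
      obtain ⟨b, hb, c, hc, rfl⟩ := Submodule.mem_sup.mp ha
      obtain ⟨d, rfl⟩ := Ideal.mem_span_singleton'.mp hb
      have h1 : x ^ k • (m : M) = 0 := m.1.2
      have h2 : c • (m : M) = 0 :=
        congrArg Subtype.val ((Submodule.mem_torsionBySet_iff _ _).mp m.2 ⟨c, hc⟩)
      change (d * x ^ k + c) • (m : M) = 0
      rw [add_smul, mul_smul, h1, h2, smul_zero, add_zero]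
  exact isNoetherian_of_injective f fun a b hab =>
    Subtype.ext (Subtype.ext (congrArg (fun z => z.1) hab))

lemma of_torsionBy {x : R} (hN : IsArtinian R N)
    (h : ArtinianSocleFinite I (Submodule.torsionBy R N x)) :
    ArtinianSocleFinite (Ideal.span {x} ⊔ I) N := by
  have := h.2
  refine ⟨hN, ?_⟩
  let f : Submodule.torsionBySet R N ((Ideal.span {x} ⊔ I : Ideal R) : Set R) →ₗ[R]
      Submodule.torsionBySet R (Submodule.torsionBy R N x) (I : Set R) :=
    LinearMap.codRestrict _ (LinearMap.codRestrict _ (Submodule.subtype _) fun m =>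
      (Submodule.mem_torsionBySet_iff _ _).mp m.2
        ⟨x, Ideal.mem_sup_left (Ideal.mem_span_singleton_self x)⟩) fun m => by
      rw [Submodule.mem_torsionBySet_iff]
      exact fun a => Subtype.ext ((Submodule.mem_torsionBySet_iff _ _).mp m.2
        ⟨a.1, Ideal.mem_sup_right a.2⟩)
  exact isNoetherian_of_injective f fun a b hab =>
    Subtype.ext (congrArg (fun z => z.1.1) hab)

/-- Closure of `ArtinianSocleFinite I` under quotients, when it is known for a smaller ideal. -/
lemma of_surjective_step [IsNoetherianRing R] {x : R}
    (ih : ∀ {A B : Type v} [AddCommGroup A] [Module R A] [AddCommGroup B] [Module R B]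
      (f : A →ₗ[R] B), Function.Surjective f → ArtinianSocleFinite I A → ArtinianSocleFinite I B)
    (g : M →ₗ[R] N) (hg : Function.Surjective g)
    (h : ArtinianSocleFinite (Ideal.span {x} ⊔ I) M) :
    ArtinianSocleFinite (Ideal.span {x} ⊔ I) N := by
  have := h.1
  let K := LinearMap.ker g
  let μ : K →ₗ[R] K := LinearMap.lsmul R K x
  have hK : ArtinianSocleFinite (Ideal.span {x} ⊔ I) K :=
    h.of_injective K.subtype K.injective_subtype
  -- `K / xK` is a quotient of `0 :_K xᵏ`
  have hKx : ArtinianSocleFinite I (K ⧸ LinearMap.range μ) := by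
    -- Fitting: `K` is artinian, so `K = ker μ^k + im μ^k` for large `k`; `k ≥ 1` puts `im μ^k`
    -- inside `xK`.
    obtain ⟨k, hk, hk1⟩ := ((LinearMap.eventually_codisjoint_ker_pow_range_pow μ).and
      (Filter.eventually_ge_atTop 1)).exists
    have hμ : ∀ (n : ℕ) (z : K), (μ ^ n) z = x ^ n • z := by
      intro n
      induction n with
      | zero => simp
      | succ n ihn =>
        intro z
        rw [pow_succ', Module.End.mul_apply, ihn, pow_succ', mul_smul]
        rfl
    refine ih ((LinearMap.range μ).mkQ.comp (Submodule.torsionBy R K (x ^ k)).subtype) ?_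
      (hK.torsionBy_pow k)
    intro y
    obtain ⟨z, rfl⟩ := Submodule.mkQ_surjective _ y
    obtain ⟨a, ha, b, hb, rfl⟩ := Submodule.mem_sup.mp
      (hk.eq_top ▸ Submodule.mem_top : z ∈ LinearMap.ker (μ ^ k) ⊔ LinearMap.range (μ ^ k))
    refine ⟨⟨a, by simpa [hμ] using ha⟩, ?_⟩
    obtain ⟨c, rfl⟩ := hb
    have hc : (μ ^ k) c ∈ LinearMap.range μ := by
      obtain ⟨j, rfl⟩ := Nat.exists_eq_add_of_le' hk1
      rw [pow_succ', Module.End.mul_apply]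
      exact ⟨_, rfl⟩
    have hc0 : (LinearMap.range μ).mkQ ((μ ^ k) c) = 0 := (Submodule.Quotient.mk_eq_zero _).mpr hc
    rw [map_add, hc0, add_zero]
    rfl
  -- Snake lemma: `(0 :_M x) → (0 :_N x) → K/xK` is exact, the second map being "lift to `M`,
  -- multiply by `x`". Instead of that map, `φ` is defined on the lifts `D`, so the cokernel of `g'`
  -- is a quotient of `D / ker φ ⊆ K/xK`, and `ih` applies.
  let L := Submodule.torsionBy R N x
  let D := L.comap g
  let g' : Submodule.torsionBy R M x →ₗ[R] L := g.restrict fun m hm => by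
    have hm : x • m = 0 := hm
    change x • g m = 0
    rw [← map_smul, hm, map_zero]
  let p : D →ₗ[R] L ⧸ LinearMap.range g' :=
    (LinearMap.range g').mkQ.comp (g.restrict fun m hm => hm)
  let φ : D →ₗ[R] K ⧸ LinearMap.range μ :=
    (LinearMap.range μ).mkQ.comp (LinearMap.restrict (LinearMap.lsmul R M x) fun m hm => by
      have hm : x • g m = 0 := hm
      change g (x • m) = 0
      rw [map_smul, hm])
  have hker : LinearMap.ker φ ≤ LinearMap.ker p := by
    intro m hm
    obtain ⟨κ, hκ⟩ := (Submodule.Quotient.mk_eq_zero _).mp (LinearMap.mem_ker.mp hm)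
    have hκ : x • κ.1 = x • m.1 := congrArg Subtype.val hκ
    have hκ0 : g κ.1 = 0 := κ.2
    refine (Submodule.Quotient.mk_eq_zero _).mpr ⟨⟨m.1 - κ.1, ?_⟩, ?_⟩
    · change x • (m.1 - κ.1) = 0
      rw [smul_sub, hκ, sub_self]
    · apply Subtype.ext
      change g (m.1 - κ.1) = g m.1
      rw [map_sub, hκ0, sub_zero]
  have hp : Function.Surjective p := by
    refine (Submodule.mkQ_surjective _).comp fun y => ?_
    obtain ⟨m, hm⟩ := hg y.1
    exact ⟨⟨m, by change g m ∈ L; rw [hm]; exact y.2⟩, Subtype.ext hm⟩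
  have h1 : ArtinianSocleFinite I (D ⧸ LinearMap.ker φ) :=
    hKx.of_injective ((LinearMap.ker φ).liftQ φ le_rfl)
      (LinearMap.ker_eq_bot.mp (Submodule.ker_liftQ_eq_bot _ _ _ le_rfl))
  have h2 : ArtinianSocleFinite I (L ⧸ LinearMap.range g') := by
    refine ih ((LinearMap.ker φ).liftQ p hker) (fun y => ?_) h1
    obtain ⟨m, rfl⟩ := hp y
    exact ⟨Submodule.Quotient.mk m, rfl⟩
  have h3 : ArtinianSocleFinite I (LinearMap.range g') :=
    ih g'.rangeRestrict g'.surjective_rangeRestrict (pow_one x ▸ h.torsionBy_pow 1)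
  exact of_torsionBy (isArtinian_of_surjective _ g hg) (of_submodule_quotient _ h3 h2)

/-- Induction on a generating set of `I`. For `I = 0` the condition says that the whole module is
artinian and noetherian. -/
lemma of_surjective [IsNoetherianRing R] (h : ArtinianSocleFinite I M) (g : M →ₗ[R] N)
    (hg : Function.Surjective g) : ArtinianSocleFinite I N := by
  classical
  obtain ⟨t, rfl⟩ := (isNoetherianRing_iff_ideal_fg R).mp inferInstance I
  change ArtinianSocleFinite (Ideal.span (t : Set R)) M at h
  induction t using Finset.induction_on generalizing M N with
  | empty =>
    have h1 := h.1
    have h2 := h.2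
    have e : ∀ {A : Type v} [AddCommGroup A] [Module R A],
        Submodule.torsionBySet R A ((Ideal.span ((∅ : Finset R) : Set R) : Ideal R) : Set R)
          = ⊤ := by
      intro A _ _
      ext z
      simp
    rw [e, isNoetherian_top_iff] at h2
    refine ⟨isArtinian_of_surjective _ g hg, ?_⟩
    rw [e, isNoetherian_top_iff]
    exact isNoetherian_of_surjective g (LinearMap.range_eq_top.mpr hg)
  | insert x s hx ih =>
    rw [Finset.coe_insert, Ideal.span_insert] at h ⊢
    exact of_surjective_step (fun f hf hA => ih f hf hA) g hg h

lemma linearMap [Module.Finite R N] (h : ArtinianSocleFinite I M) :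
    ArtinianSocleFinite I (N →ₗ[R] M) := by
  obtain ⟨n, f, hf⟩ := Module.Finite.exists_fin' R N
  refine (h.pi n).of_injective
    ((LinearMap.pi fun i => LinearMap.applyₗ (f (Pi.single i 1))) : (N →ₗ[R] M) →ₗ[R] Fin n → M) ?_
  intro a b hab
  have : a.comp f = b.comp f := by
    ext i
    simpa using congrFun hab i
  exact (LinearMap.cancel_right hf).mp this

end ArtinianSocleFinite

end Torsion

/-! ### Cofiniteness of artinian modules and minimal primes -/

section Characterization

variable {R : Type u} [CommRing R]

/-- Dimension shifting: for `0 → K → F → N → 0` with `F` finite free, `Ext^{n+1}(N, M)` is a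
quotient of `Ext^n(K, M)`. -/
lemma ArtinianSocleFinite.ext [IsNoetherianRing R] {I : Ideal R} {M : ModuleCat.{u} R}
    (h : ArtinianSocleFinite I M) (i : ℕ) (N : ModuleCat.{u} R) [Module.Finite R N] :
    ArtinianSocleFinite I (Abelian.Ext N M i) := by
  induction i generalizing N with
  | zero =>
    exact (h.linearMap (N := N)).of_injective
      (Abelian.Ext.linearEquiv₀.trans ModuleCat.homLinearEquiv : Abelian.Ext N M 0 ≃ₗ[R] _)
      (LinearEquiv.injective _)
  | succ n ih =>
    obtain ⟨N, _, _, _, _, f, surjf⟩ := Module.exists_finite_presentation R N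
    let exac := LinearMap.shortExact_shortComplexKer surjf
    exact (ih _).of_surjective (exac.extClass.precompOfLinear R M (add_comm 1 n))
      (precomp_extClass_surjective_of_projective_X₂ M exac n)

/-- The scalar action on Ext may be computed through the first argument, where `r` acts as zero. -/
lemma smul_ext_quotient_eq_zero {I : Ideal R} {M : ModuleCat.{u} R} {i : ℕ}
    (x : Abelian.Ext (ModuleCat.of R (R ⧸ I)) M i) {r : R} (hr : r ∈ I) : r • x = 0 := by
  have h0 : r • 𝟙 (ModuleCat.of R (R ⧸ I)) = 0 := by
    refine ModuleCat.hom_ext (LinearMap.ext fun y => ?_)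
    obtain ⟨y, rfl⟩ := Ideal.Quotient.mk_surjective y
    exact Ideal.Quotient.eq_zero_iff_mem.mpr (I.mul_mem_right y hr)
  calc r • x = r • (Abelian.Ext.mk₀ (𝟙 (ModuleCat.of R (R ⧸ I)))).comp x (zero_add i) := by
        rw [Abelian.Ext.mk₀_id_comp]
    _ = 0 := by
        rw [← Abelian.Ext.smul_comp, ← Abelian.Ext.mk₀_smul, h0, Abelian.Ext.mk₀_zero,
          Abelian.Ext.zero_comp]

lemma ArtinianSocleFinite.finite_ext [IsNoetherianRing R] {I : Ideal R} {M : ModuleCat.{u} R}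
    (h : ArtinianSocleFinite I M) (i : ℕ) :
    Module.Finite R (Abelian.Ext (ModuleCat.of R (R ⧸ I)) M i) := by
  have h2 := (h.ext i (ModuleCat.of R (R ⧸ I))).2
  have : Submodule.torsionBySet R (Abelian.Ext (ModuleCat.of R (R ⧸ I)) M i) (I : Set R) = ⊤ := by
    rw [eq_top_iff]
    intro x _
    rw [Submodule.mem_torsionBySet_iff]
    exact fun r => smul_ext_quotient_eq_zero x r.2
  rw [this, isNoetherian_top_iff] at h2
  infer_instance

lemma finite_torsion_of_finite_ext_zero {I : Ideal R} {M : ModuleCat.{u} R}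
    [Module.Finite R (Abelian.Ext (ModuleCat.of R (R ⧸ I)) M 0)] :
    Module.Finite R (Submodule.torsionBySet R M (I : Set R)) := by
  have : Module.Finite R ((R ⧸ I) →ₗ[R] M) := Module.Finite.equiv
    (Abelian.Ext.linearEquiv₀.trans ModuleCat.homLinearEquiv :
      Abelian.Ext (ModuleCat.of R (R ⧸ I)) M 0 ≃ₗ[R] ((R ⧸ I) →ₗ[R] M))
  let f : ((R ⧸ I) →ₗ[R] M) →ₗ[R] Submodule.torsionBySet R M (I : Set R) :=
    LinearMap.codRestrict _ (LinearMap.applyₗ (Submodule.Quotient.mk 1 : R ⧸ I)) fun g => by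
      rw [Submodule.mem_torsionBySet_iff]
      intro a
      change a.1 • g (Submodule.Quotient.mk 1) = 0
      rw [← map_smul, ← Submodule.Quotient.mk_smul,
        (Submodule.Quotient.mk_eq_zero I).mpr (by simp), map_zero]
  refine Module.Finite.of_surjective f fun m => ?_
  refine ⟨I.liftQ (LinearMap.toSpanSingleton R M m.1) fun a ha => ?_, Subtype.ext ?_⟩
  · exact (Submodule.mem_torsionBySet_iff _ _).mp m.2 ⟨a, ha⟩
  · exact one_smul R m.1

/-- For `p` in the support, `R/p` is a quotient of some cyclic submodule `Rm`, so it is an artinian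
domain, hence a field, and `p` is the maximal ideal. -/
lemma support_subset_zeroLocus_of_isArtinian [IsLocalRing R] {I : Ideal R} (hI : I ≠ ⊤)
    (M : Type u) [AddCommGroup M] [Module R M] [IsArtinian R M] :
    Module.support R M ⊆ PrimeSpectrum.zeroLocus (I : Set R) := by
  intro p hp
  obtain ⟨m, hm⟩ := Module.mem_support_iff_exists_annihilator.mp hp
  have h1 : IsArtinian R (R ⧸ p.asIdeal) := by
    have h2 : IsArtinian R (R ⧸ LinearMap.ker (LinearMap.toSpanSingleton R M m)) :=
      isArtinian_of_linearEquiv (LinearMap.quotKerEquivRange _).symm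
    have h3 : LinearMap.ker (LinearMap.toSpanSingleton R M m) ≤ p.asIdeal := fun a ha =>
      hm ((Submodule.mem_annihilator_span_singleton _ _).mpr ha)
    exact isArtinian_of_surjective _ (Submodule.factor h3) (Submodule.factor_surjective h3)
  have h3 : IsArtinianRing (R ⧸ p.asIdeal) := isArtinian_of_tower R h1
  have h4 : p.asIdeal.IsMaximal :=
    Ideal.Quotient.maximal_of_isField _ (IsArtinianRing.isField_of_isDomain _)
  rw [PrimeSpectrum.mem_zeroLocus, SetLike.coe_subset_coe, IsLocalRing.eq_maximalIdeal h4]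
  exact IsLocalRing.le_maximalIdeal hI

lemma artinianCofinite_iff [IsNoetherianRing R] [IsLocalRing R] {I : Ideal R} (hI : I ≠ ⊤)
    (M : ModuleCat.{u} R) : artinianCofinite I M ↔ ArtinianSocleFinite I M := by
  constructor
  · rintro ⟨h1, -, h2⟩
    have := h2 0
    have := finite_torsion_of_finite_ext_zero (I := I) (M := M)
    exact ⟨h1, inferInstance⟩
  · intro h
    have := h.1
    exact ⟨h.1, support_subset_zeroLocus_of_isArtinian hI M, h.finite_ext⟩

lemma ArtinianSocleFinite.anti {I J : Ideal R} (hIJ : I ≤ J) {M : Type u} [AddCommGroup M]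
    [Module R M] (h : ArtinianSocleFinite I M) : ArtinianSocleFinite J M :=
  have := h.2
  ⟨h.1, isNoetherian_torsion_anti hIJ⟩

lemma artinianSocleFinite_iff_minimalPrimes [IsNoetherianRing R] {I : Ideal R} (hI : I ≠ ⊤)
    (M : Type u) [AddCommGroup M] [Module R M] :
    ArtinianSocleFinite I M ↔ ∀ p ∈ I.minimalPrimes, ArtinianSocleFinite p M := by
  refine ⟨fun h p hp => h.anti hp.1.2, fun h => ?_⟩
  obtain ⟨⟨q, hq⟩⟩ := Ideal.nonempty_minimalPrimes hI
  refine ⟨(h q hq).1, ?_⟩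
  have hfin := Ideal.finite_minimalPrimes_of_isNoetherianRing R I
  have h1 := isNoetherian_torsion_prod (M := M) hfin.toFinset
    fun p hp => (h p (hfin.mem_toFinset.mp hp)).2
  have hle : (∏ p ∈ hfin.toFinset, p) ≤ I.radical := by
    rw [← Ideal.sInf_minimalPrimes]
    exact le_sInf fun p hp => Ideal.prod_le_inf.trans
      (Finset.inf_le (f := id) (hfin.mem_toFinset.mpr hp))
  obtain ⟨k, hk⟩ := Ideal.exists_pow_le_of_le_radical_of_fg_radical hle
    (IsNoetherian.noetherian _)
  have := isNoetherian_torsion_pow (M := M) (∏ p ∈ hfin.toFinset, p) k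
  exact isNoetherian_torsion_anti hk

lemma artinianCofinite_eq_iInf_minimalPrimes [IsNoetherianRing R] [IsLocalRing R] {I : Ideal R}
    (hI : I ≠ ⊤) :
    artinianCofinite I = ⨅ p ∈ I.minimalPrimes, artinianCofinite (R := R) p := by
  ext M
  simp only [iInf_apply, iInf_Prop_eq]
  rw [artinianCofinite_iff hI, artinianSocleFinite_iff_minimalPrimes hI]
  exact forall₂_congr fun p hp => (artinianCofinite_iff hp.1.1.ne_top M).symm

end Characterization

/-! ### Primes in the Melkersson subset -/

section Melkersson

variable {R : Type u} [CommRing R] [IsNoetherianRing R] [IsLocalRing R]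

open IsLocalRing in
lemma isArtinian_of_le_span_singleton {I : Ideal R} (hI : maximalIdeal R ∈ I.minimalPrimes)
    {M : Type u} [AddCommGroup M] [Module R M] {y : M} (hy : ∀ r ∈ I, r • y = 0)
    {T : Submodule R M} (hT : T ≤ Submodule.span R {y}) : IsArtinian R T := by
  have h1 : IsArtinianRing (R ⧸ I) := quotient_artinian_of_mem_minimalPrimes_of_isLocalRing I hI
  have h2 : IsArtinian R (R ⧸ I) :=
    isArtinian_of_surjective_algebraMap (R := R ⧸ I) Ideal.Quotient.mk_surjective
  have hker : I ≤ LinearMap.ker (LinearMap.toSpanSingleton R M y) := hy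
  have h3 : IsArtinian R (LinearMap.range (Submodule.liftQ I (LinearMap.toSpanSingleton R M y) hker)) :=
    inferInstance
  rw [Submodule.range_liftQ, LinearMap.range_toSpanSingleton] at h3
  exact isArtinian_of_le hT

open IsLocalRing in
/-- If `q ⊇ I` is a prime with `dim R/q ≤ 1`, the module `Frac(R/q) / (R/q)` shows that every
prime of the Melkersson subset of the artinian `I`-cofinite modules is contained in `q`. -/
lemma le_of_satisfiesC_artinianCofinite {I q : Ideal R} [q.IsPrime] (hIq : I ≤ q)
    (hdim : ∀ b ∈ maximalIdeal R, b ∉ q → maximalIdeal R ∈ (q ⊔ Ideal.span {b}).minimalPrimes)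
    {p : Ideal R} (hpm : p ≤ maximalIdeal R) (hp : SatisfiesC p (artinianCofinite I)) :
    p ≤ q := by
  have hI : I ≠ ⊤ := fun h => Ideal.IsPrime.ne_top' (I := q) (top_le_iff.mp (h ▸ hIq))
  by_contra hpq
  obtain ⟨x, hxp, hxq⟩ := SetLike.not_le_iff_exists.mp hpq
  have hxm := hpm hxp
  let K := FractionRing (R ⧸ q)
  have hι : ∀ r : R, algebraMap R K r = 0 ↔ r ∈ q := fun r => by
    rw [IsScalarTower.algebraMap_apply R (R ⧸ q) K,
      FaithfulSMul.algebraMap_eq_zero_iff (R ⧸ q) K]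
    exact Ideal.Quotient.eq_zero_iff_mem
  have hfrac : ∀ z : K, ∃ a b : R, b ∉ q ∧ b • z = algebraMap R K a := fun z => by
    obtain ⟨a, b, hb, rfl⟩ := IsFractionRing.div_surjective (A := R ⧸ q) z
    obtain ⟨a, rfl⟩ := Ideal.Quotient.mk_surjective a
    obtain ⟨b, rfl⟩ := Ideal.Quotient.mk_surjective b
    have hbq : b ∉ q := fun h => nonZeroDivisors.ne_zero hb (Ideal.Quotient.eq_zero_iff_mem.mpr h)
    refine ⟨a, b, hbq, ?_⟩
    have hb0 : algebraMap R K b ≠ 0 := fun h => hbq ((hι b).mp h)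
    rw [Algebra.smul_def]
    exact mul_div_cancel₀ _ hb0
  let V : Submodule R K := LinearMap.range (Algebra.linearMap R K)
  let M := K ⧸ V
  have hx0 : algebraMap R K x ≠ 0 := fun h => hxq ((hι x).mp h)
  have hqM : ∀ r ∈ q, ∀ z : M, r • z = 0 := by
    intro r hr z
    obtain ⟨z, rfl⟩ := Submodule.Quotient.mk_surjective _ z
    rw [← Submodule.Quotient.mk_smul, Algebra.smul_def, (hι r).mpr hr, zero_mul,
      Submodule.Quotient.mk_zero]
  -- The class of `1/x` generates `(0 :_M x)`, which contains `(0 :_M p)`. It is killed by `q +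
  -- (x)`, over which the maximal ideal is minimal, so it spans a module of finite length.
  let y : M := Submodule.Quotient.mk (algebraMap R K x)⁻¹
  have hxy : x • y = 0 := by
    rw [← Submodule.Quotient.mk_smul, Algebra.smul_def, mul_inv_cancel₀ hx0]
    exact (Submodule.Quotient.mk_eq_zero V).mpr ⟨1, map_one (algebraMap R K)⟩
  have hy : ∀ r ∈ q ⊔ Ideal.span {x}, r • y = 0 := by
    intro r hr
    obtain ⟨a, ha, b, hb, rfl⟩ := Submodule.mem_sup.mp hr
    obtain ⟨c, rfl⟩ := Ideal.mem_span_singleton'.mp hb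
    rw [add_smul, hqM a ha, mul_smul, hxy, smul_zero, add_zero]
  let T : Submodule R M := Submodule.torsionBySet R M (p : Set R)
  have hT : T ≤ Submodule.span R {y} := by
    intro z hz
    have hz := (Submodule.mem_torsionBySet_iff _ _).mp hz ⟨x, hxp⟩
    obtain ⟨z, rfl⟩ := Submodule.Quotient.mk_surjective _ z
    obtain ⟨r, hr⟩ := (Submodule.Quotient.mk_eq_zero V).mp hz
    refine Submodule.mem_span_singleton.mpr ⟨r, ?_⟩
    have hr : algebraMap R K r = algebraMap R K x * z := by
      rw [← Algebra.smul_def]; exact hr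
    rw [← Submodule.Quotient.mk_smul, Algebra.smul_def, hr, mul_right_comm,
      mul_inv_cancel₀ hx0, one_mul]
  have hTS : ArtinianSocleFinite I T := by
    have := isArtinian_of_le_span_singleton (hdim x hxm hxq) hy hT
    have : IsNoetherian R T := isNoetherian_of_le hT
    exact ⟨inferInstance, inferInstance⟩
  have hgamma : gamma p M = ⊤ := by
    rw [eq_top_iff]
    intro z _
    obtain ⟨z, rfl⟩ := Submodule.Quotient.mk_surjective _ z
    obtain ⟨a, b, hb, hab⟩ := hfrac z
    have hbz : b • (Submodule.Quotient.mk z : M) = 0 :=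
      (Submodule.Quotient.mk_eq_zero V).mpr ⟨a, hab.symm⟩
    -- A denominator `b` of `z` and `q` both kill the class of `z`. If `b` is a nonunit, `q + (b)`
    -- contains a power of the maximal ideal, hence of `p`.
    by_cases hbm : b ∈ maximalIdeal R
    · have := quotient_artinian_of_mem_minimalPrimes_of_isLocalRing _ (hdim b hbm hb)
      obtain ⟨n, hn⟩ := exists_maximalIdeal_pow_le_of_isArtinianRing_quotient
        (q ⊔ Ideal.span {b})
      refine ⟨n, fun r hr => ?_⟩
      obtain ⟨c, hc, d, hd, rfl⟩ := Submodule.mem_sup.mp (hn (Ideal.pow_right_mono hpm n hr))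
      obtain ⟨e, rfl⟩ := Ideal.mem_span_singleton'.mp hd
      rw [add_smul, hqM c hc, mul_smul, hbz, smul_zero, add_zero]
    · have hu : IsUnit b := by simpa using hbm
      rw [hu.smul_eq_zero] at hbz
      rw [hbz]
      exact Submodule.zero_mem _
  have hM : ArtinianSocleFinite I M :=
    (artinianCofinite_iff hI (ModuleCat.of R M)).mp
      (hp (ModuleCat.of R M) hgamma ((artinianCofinite_iff hI (ModuleCat.of R T)).mpr hTS))
  have htop : Submodule.torsionBySet R M (I : Set R) = ⊤ := by
    rw [eq_top_iff]
    intro z _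
    rw [Submodule.mem_torsionBySet_iff]
    exact fun r => hqM r (hIq r.2) z
  have hnoeth := hM.2
  rw [htop, isNoetherian_top_iff] at hnoeth
  -- Nakayama applies because `M = xM` with `x` in the maximal ideal. Then `y = 0` puts `1/x` in
  -- `R/q`, which is absurd for a nonunit `x`.
  have hbot : (⊤ : Submodule R M) = ⊥ := by
    refine Submodule.eq_bot_of_le_smul_of_le_jacobson_bot (maximalIdeal R) _
      (IsNoetherian.noetherian _) (fun z _ => ?_) (jacobson_eq_maximalIdeal ⊥ bot_ne_top).ge
    obtain ⟨z, rfl⟩ := Submodule.Quotient.mk_surjective _ z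
    have : z = x • ((algebraMap R K x)⁻¹ * z) := by
      rw [Algebra.smul_def, mul_inv_cancel_left₀ hx0]
    rw [this, Submodule.Quotient.mk_smul]
    exact Submodule.smul_mem_smul hxm Submodule.mem_top
  have hy0 : y = 0 := (Submodule.mem_bot R).mp (hbot ▸ Submodule.mem_top)
  obtain ⟨r, hr⟩ := (Submodule.Quotient.mk_eq_zero V).mp hy0
  have hr : algebraMap R K r = (algebraMap R K x)⁻¹ := hr
  have h1 : x * r - 1 ∈ q := by
    rw [← hι, map_sub, map_mul, hr, mul_inv_cancel₀ hx0, map_one, sub_self]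
  have h2 : (1 : R) ∈ maximalIdeal R := by
    rw [← sub_sub_cancel (x * r) 1]
    exact (maximalIdeal R).sub_mem ((maximalIdeal R).mul_mem_right r hxm)
      (le_maximalIdeal (Ideal.IsPrime.ne_top' (I := q)) h1)
  exact (Ideal.ne_top_iff_one _).mp (maximalIdeal.isMaximal R).ne_top h2

-- Strictly enlarging the prime `q` raises the height, so `q + (b)` has height at least `d`, the
-- height of the maximal ideal that contains it.
open IsLocalRing in
lemma maximalIdeal_mem_minimalPrimes_sup_span_singleton {d : ℕ} (hd : ringKrullDim R = d)
    {q : Ideal R} [q.IsPrime] (hq : ((d - 1 : ℕ) : ℕ∞) ≤ q.height) {b : R}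
    (hb : b ∈ maximalIdeal R) (hbq : b ∉ q) :
    maximalIdeal R ∈ (q ⊔ Ideal.span {b}).minimalPrimes := by
  have hm : (maximalIdeal R).height = d := by
    have := maximalIdeal_height_eq_ringKrullDim (R := R)
    rw [hd] at this
    exact_mod_cast this
  refine Ideal.mem_minimalPrimes_of_height_le (sup_le (le_maximalIdeal Ideal.IsPrime.ne_top')
    ((Ideal.span_singleton_le_iff_mem _).mpr hb)) ?_
  have hlt : q < q ⊔ Ideal.span {b} := lt_of_le_of_ne le_sup_left fun h =>
    hbq (h ▸ Ideal.mem_sup_right (Ideal.mem_span_singleton_self b))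
  have h1 := Order.add_one_le_of_lt (Ideal.height_strict_mono_of_isPrime hlt)
  rw [hm]
  refine le_trans ?_ h1
  calc (d : ℕ∞) ≤ ((d - 1 : ℕ) : ℕ∞) + 1 := by norm_cast; omega
    _ ≤ q.height + 1 := by gcongr

end Melkersson

end CofiniteModules

theorem mainTheorem11 {R : Type u} [CommRing R] [IsNoetherianRing R] [IsLocalRing R]
    (d : ℕ) (hd : ringKrullDim R = d) (hd1 : 1 ≤ d)
    (𝔞 : Ideal R) (h𝔞 : 𝔞.height = ((d - 1 : ℕ) : ℕ∞)) :
    CofiniteModules.artinianCofinite 𝔞 =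
        (⨅ 𝔭 ∈ 𝔞.minimalPrimes, CofiniteModules.artinianCofinite 𝔭) ∧
      (∀ 𝔭 ∈ CofiniteModules.melkerssonSubsetGE (CofiniteModules.artinianCofinite 𝔞) (d - 1),
        𝔭.asIdeal ∈ 𝔞.minimalPrimes) ∧
      (CofiniteModules.melkerssonSubsetGE (CofiniteModules.artinianCofinite 𝔞)
        (d - 1)).Subsingleton := by
  have hne : 𝔞 ≠ ⊤ := by
    rintro rfl
    rw [Ideal.height_top] at h𝔞
    exact ENat.top_ne_natCast _ h𝔞
  -- The height of `𝔞` is the infimum of the heights of its minimal primes, and an infimum of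
  -- extended naturals with finite value is attained.
  obtain ⟨𝔮, h𝔮, hht⟩ : ∃ 𝔮 ∈ 𝔞.minimalPrimes, 𝔮.height = ((d - 1 : ℕ) : ℕ∞) := by
    by_contra! hcon
    have h1 : ((d - 1 : ℕ) : ℕ∞) + 1 ≤ 𝔞.height := by
      rw [𝔞.height_eq_inf_minimalPrimes]
      exact le_iInf₂ fun J hJ => Order.add_one_le_of_lt
        (lt_of_le_of_ne (h𝔞 ▸ Ideal.height_mono hJ.1.2) (hcon J hJ).symm)
    rw [h𝔞] at h1
    norm_cast at h1
    omega
  have := h𝔮.1.1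
  have key : ∀ 𝔭 ∈ CofiniteModules.melkerssonSubsetGE (CofiniteModules.artinianCofinite 𝔞) (d - 1),
      𝔭.asIdeal = 𝔮 := fun 𝔭 h𝔭 =>
    Ideal.eq_of_le_of_height_le _
      (CofiniteModules.le_of_satisfiesC_artinianCofinite h𝔮.1.2
        (fun _ => CofiniteModules.maximalIdeal_mem_minimalPrimes_sup_span_singleton hd hht.ge)
        (IsLocalRing.le_maximalIdeal 𝔭.2.ne_top) h𝔭.1)
      (hht.trans_le h𝔭.2)
  exact ⟨CofiniteModules.artinianCofinite_eq_iInf_minimalPrimes hne,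
    fun 𝔭 h𝔭 => key 𝔭 h𝔭 ▸ h𝔮,
    fun 𝔭 h𝔭 𝔭' h𝔭' => PrimeSpectrum.ext ((key 𝔭 h𝔭).trans (key 𝔭' h𝔭').symm)⟩
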